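/- Consider diagrams of oriented spatial trivalent graphs all of whose trivalent vertices are sources or sinks, and the 28 oriented Reidemeister-type moves $\Omega1a$–$\Omega1d$, $\Omega2a$–$\Omega2d$, $\Omega3a$–$\Omega3h$, $\Omega4a$–$\Omega4h$, $\Omega5a$–$\Omega5d$ between them: the 16 oriented versions of the classical Reidemeister moves (with Polyak's labels), the eight oriented versions of the move $\Omega4$ that slides a strand across a vertex, exchanging one crossing of the strand with a leg for two crossings with the other two legs, and the four oriented versions of the move $\Omega5$ that introduces or removes a crossing between two legs at a vertex. In $\Omega4a,\Omega4b$ the strand passes under a sink, in $\Omega4c,\Omega4d$ over a sink, in $\Omega4e,\Omega4f$ under a source, and in $\Omega4g,\Omega4h$ over a source; the moves $\Omega4a,\Omega4d,\Omega4f,\Omega4g$ exchange one negative crossing for two positive ones, and the moves $\Omega4b,\Omega4c,\Omega4e,\Omega4h$ exchange one positive crossing for two negative ones. A set $S$ of these moves realizes a move $\Omega$ if one side of $\Omega$ can be turned into the other by a finite sequence of planar isotopies and moves in $S$ (in either direction), all inside the disk in which $\Omega$ takes place. The set $S$ is a generating set if it realizes all 28 moves, and it is a minimal generating set if, moreover,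 no generating set has fewer elements. **Theorem.** Every minimal generating set contains exactly four $\Omega4$ moves, exactly one from each of the four pairs $\{\Omega4a,\Omega4b\}$, $\{\Omega4c,\Omega4d\}$, $\{\Omega4e,\Omega4f\}$, $\{\Omega4g,\Omega4h\}$. Moreover: 1. every generating set, minimal or not, contains at least one move from each of the four pairs; 2. each move of a pair is realized by the other move of that pair together with the four $\Omega2$ moves; 3. every choice of one move from each of the four pairs occurs: for each set $T$ consisting of one move from each pair there is a minimal generating set whose $\Omega4$ moves are exactly those in $T$. -/

import Mathlib

namespace TrivalentDiagram

/-! ### Oriented diagrams in a rectangle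

A diagram of (a piece of) an oriented spatial trivalent graph inside a disk is drawn in a rectangle,
in general position with respect to the height function: the disk is the rectangle, the end points
of the diagram lie on its bottom and top sides, and the diagram is a stack of horizontal slices,
read from bottom to top, each of which consists of vertical strands and exactly one elementary piece
(a local minimum, a local maximum, a crossing or a trivalent vertex). Every trivalent vertex is drawn
with one leg below it and two legs above it, as can be arranged by a planar isotopy. -/

/-- Direction in which an oriented strand runs through a horizontal level. -/
inductive Dir where
  | up
  | down
  deriving DecidableEq

/-- The opposite direction. -/
def Dir.flip : Dir → Dir
  | .up => .down
  | .down => .up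

/-- The elementary pieces of a diagram. -/
inductive Piece where
  /-- Local minimum; its left end runs in direction `a`, its right end in the opposite one. -/
  | cup (a : Dir)
  /-- Local maximum; its left end runs in direction `a`, its right end in the opposite one. -/
  | cap (a : Dir)
  /-- Crossing of the strand joining bottom left to top right, which runs in direction `a`, with the
  strand joining bottom right to top left, which runs in direction `b`. The first of them passes
  over the second if `isOver` is `true`, and under it if `isOver` is `false`. So the crossing is
  positive if and only if (`a = b` exactly when `isOver = true`). -/
  | cross (a b : Dir) (isOver : Bool)
  /-- Trivalent vertex with one leg below it, which runs in direction `a`, and two legs above it,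
  which run in the opposite direction: a sink if `a` is `up`, a source if `a` is `down`. -/
  | vertex (a : Dir)

/-- The strands entering a piece from below, from left to right. -/
def Piece.bottom : Piece → List Dir
  | .cup _ => []
  | .cap a => [a, a.flip]
  | .cross a b _ => [a, b]
  | .vertex a => [a]

/-- The strands leaving a piece at its top, from left to right. -/
def Piece.top : Piece → List Dir
  | .cup a => [a, a.flip]
  | .cap _ => []
  | .cross a b _ => [b, a]
  | .vertex a => [a.flip, a.flip]

/-- A horizontal slice: one elementary piece with vertical strands to its left and right. -/
structure Slice where
  left : List Dir
  piece : Piece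
  right : List Dir

/-- The strands of a slice at its bottom level. -/
def Slice.bottom (s : Slice) : List Dir := s.left ++ s.piece.bottom ++ s.right

/-- The strands of a slice at its top level. -/
def Slice.top (s : Slice) : List Dir := s.left ++ s.piece.top ++ s.right

/-- `IsStack p w q`: the slices `w`, stacked from bottom to top, fit together, with the strands `p`
at the bottom and `q` at the top. The empty stack is a family of vertical strands. -/
def IsStack : List Dir → List Slice → List Dir → Prop
  | p, [], q => p = q
  | p, s :: w, q => p = s.bottom ∧ IsStack s.top w q

/-- Diagrams in a rectangle with bottom end points `p` and top end points `q`. -/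
structure Diagram (p q : List Dir) where
  slices : List Slice
  isStack : IsStack p slices q

/-- Put vertical strands `l` to the left and `r` to the right of a stack of slices. -/
def pad (l r : List Dir) (w : List Slice) : List Slice :=
  w.map fun s => ⟨l ++ s.left, s.piece, s.right ++ r⟩

/-- The elementary planar isotopies. Applied in smaller rectangles, they generate planar isotopy
relative to the boundary of the rectangle (they are the axioms of the free pivotal category, whose
morphisms are the planar diagrams up to planar isotopy): cancelling a minimum against an adjacent maximum, turning a crossing by a quarter turn,
turning a trivalent vertex by a third of a turn, and exchanging the heights of two pieces that are
next to each other (with vertical strands `m` between them). -/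
inductive Isotopy : List Slice → List Slice → Prop where
  | zigzagLeft (a : Dir) :
      Isotopy [⟨[a], .cup a.flip, []⟩, ⟨[], .cap a, [a]⟩] []
  | zigzagRight (a : Dir) :
      Isotopy [⟨[], .cup a, [a]⟩, ⟨[a], .cap a.flip, []⟩] []
  | turnCross (a b : Dir) (isOver : Bool) :
      Isotopy [⟨[], .cross a b isOver, []⟩]
        [⟨[], .cup b, [a, b]⟩, ⟨[b], .cross b.flip a (!isOver), [b]⟩, ⟨[b, a], .cap b.flip, []⟩]
  | turnVertex (a : Dir) :
      Isotopy [⟨[], .vertex a, []⟩]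
        [⟨[], .cup a.flip, [a]⟩, ⟨[a.flip], .vertex a, [a]⟩,
          ⟨[a.flip, a.flip], .cap a.flip, []⟩]
  | exchange (g h : Piece) (m : List Dir) :
      Isotopy [⟨[], g, m ++ h.bottom⟩, ⟨g.top ++ m, h, []⟩]
        [⟨g.bottom ++ m, h, []⟩, ⟨[], g, m ++ h.top⟩]

/-! ### The oriented Reidemeister-type moves -/

/-- The names of the 28 oriented Reidemeister-type moves. -/
inductive Move where
  | om1a | om1b | om1c | om1d
  | om2a | om2b | om2c | om2d
  | om3a | om3b | om3c | om3d | om3e | om3f | om3g | om3h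
  | om4a | om4b | om4c | om4d | om4e | om4f | om4g | om4h
  | om5a | om5b | om5c | om5d
  deriving DecidableEq

/-- The two sides of a move: two diagrams in one rectangle, with the same end points. -/
structure MovePair where
  bottom : List Dir
  top : List Dir
  lhs : Diagram bottom top
  rhs : Diagram bottom top

/-- A strand and a clockwise curl, with a positive crossing if `isOver` is `true` and a negative one
otherwise. -/
def clockwiseCurl (isOver : Bool) : MovePair where
  bottom := [.up]
  top := [.up]
  lhs := ⟨[], rfl⟩
  rhs := ⟨[⟨[.up], .cup .up, []⟩, ⟨[], .cross .up .up isOver, [.down]⟩, ⟨[.up], .cap .up, []⟩],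
    by simp [IsStack, Slice.bottom, Slice.top, Piece.bottom, Piece.top, Dir.flip]⟩

/-- A strand and a counter-clockwise curl, with a positive crossing if `isOver` is `true` and a
negative one otherwise. -/
def counterclockwiseCurl (isOver : Bool) : MovePair where
  bottom := [.up]
  top := [.up]
  lhs := ⟨[], rfl⟩
  rhs := ⟨[⟨[], .cup .down, [.up]⟩, ⟨[.down], .cross .up .up isOver, []⟩, ⟨[], .cap .down, [.up]⟩],
    by simp [IsStack, Slice.bottom, Slice.top, Piece.bottom, Piece.top, Dir.flip]⟩

/-- Two disjoint strands with directions `a` and `b`, and the same strands after the left one has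
been pushed over (`isOver = true`) or under (`isOver = false`) the right one, forming a bigon. -/
def bigon (a b : Dir) (isOver : Bool) : MovePair where
  bottom := [a, b]
  top := [a, b]
  lhs := ⟨[], rfl⟩
  rhs := ⟨[⟨[], .cross a b isOver, []⟩, ⟨[], .cross b a (!isOver), []⟩],
    by simp [IsStack, Slice.bottom, Slice.top, Piece.bottom, Piece.top]⟩

/-- Three pairwise crossing strands with directions `a`, `b`, `c`, numbered from left to right at
the bottom; `o₁₂`, `o₁₃`, `o₂₃` tell whether the strand with the smaller number is the upper one. -/
def triangle (a b c : Dir) (o₁₂ o₁₃ o₂₃ : Bool) : MovePair where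
  bottom := [a, b, c]
  top := [c, b, a]
  lhs := ⟨[⟨[], .cross a b o₁₂, [c]⟩, ⟨[b], .cross a c o₁₃, []⟩, ⟨[], .cross b c o₂₃, [a]⟩],
    by simp [IsStack, Slice.bottom, Slice.top, Piece.bottom, Piece.top]⟩
  rhs := ⟨[⟨[a], .cross b c o₂₃, []⟩, ⟨[], .cross a c o₁₃, [b]⟩, ⟨[c], .cross a b o₁₂, []⟩],
    by simp [IsStack, Slice.bottom, Slice.top, Piece.bottom, Piece.top]⟩

/-- A strand in direction `a`, running from the bottom left to the top right, slides over
(`isOver = true`) or under (`isOver = false`) the vertex whose lower leg has direction `d`: it crosses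
the leg below the vertex on one side of the move, and the two legs above it on the other side. -/
def vertexSlide (d a : Dir) (isOver : Bool) : MovePair where
  bottom := [a, d]
  top := [d.flip, d.flip, a]
  lhs := ⟨[⟨[], .cross a d isOver, []⟩, ⟨[], .vertex d, [a]⟩],
    by simp [IsStack, Slice.bottom, Slice.top, Piece.bottom, Piece.top]⟩
  rhs := ⟨[⟨[a], .vertex d, []⟩, ⟨[], .cross a d.flip isOver, [d.flip]⟩,
      ⟨[d.flip], .cross a d.flip isOver, []⟩],
    by simp [IsStack, Slice.bottom, Slice.top, Piece.bottom, Piece.top]⟩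

/-- A vertex whose lower leg has direction `d`, without and with a crossing of its two upper legs,
positive if `isOver` is `true` and negative otherwise. -/
def vertexTwist (d : Dir) (isOver : Bool) : MovePair where
  bottom := [d]
  top := [d.flip, d.flip]
  lhs := ⟨[⟨[], .vertex d, []⟩],
    by simp [IsStack, Slice.bottom, Slice.top, Piece.bottom, Piece.top]⟩
  rhs := ⟨[⟨[], .vertex d, []⟩, ⟨[], .cross d.flip d.flip isOver, []⟩],
    by simp [IsStack, Slice.bottom, Slice.top, Piece.bottom, Piece.top]⟩

/-- The two diagrams related by each move.

* Type 1: `om1a`, `om1b` have a positive crossing and a clockwise, counter-clockwise loop; `om1c`,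
  `om1d` have a negative crossing and a clockwise, counter-clockwise loop.
* Type 2: parallel strands for `om2a` (along the bigon first a positive, then a negative crossing)
  and `om2b` (first negative, then positive); antiparallel strands for `om2c` (counter-clockwise
  bigon) and `om2d` (clockwise bigon). In `om2c` and `om2d` it does not matter which strand is over:
  a half turn exchanges the two choices.
* Type 3, with the signs of the crossings top/middle, top/bottom, middle/bottom of the three
  strands: `om3a` + - +, `om3b` + + +, `om3c` - - +, `om3d` + + -, `om3e` - + +, `om3f` + - -,
  `om3g` - - -, `om3h` - + -.
* Type 4: the strand passes under a sink (`om4a`, `om4b`), over a sink (`om4c`, `om4d`), under a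
  source (`om4e`, `om4f`), over a source (`om4g`, `om4h`). One negative crossing is exchanged for
  two positive ones in `om4a`, `om4d`, `om4f`, `om4g`; one positive crossing is exchanged for two
  negative ones in `om4b`, `om4c`, `om4e`, `om4h`.
* Type 5: a positive (`om5a`), negative (`om5b`) crossing at a sink, a positive (`om5c`), negative
  (`om5d`) crossing at a source. -/
def Move.pair : Move → MovePair
  | .om1a => clockwiseCurl true
  | .om1b => counterclockwiseCurl true
  | .om1c => clockwiseCurl false
  | .om1d => counterclockwiseCurl false
  | .om2a => bigon .up .up true
  | .om2b => bigon .up .up false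
  | .om2c => bigon .up .down true
  | .om2d => bigon .down .up true
  | .om3a => triangle .up .down .up true true false
  | .om3b => triangle .up .up .up true true true
  | .om3c => triangle .up .down .down true true true
  | .om3d => triangle .up .up .up true true false
  | .om3e => triangle .up .up .down true true false
  | .om3f => triangle .up .up .down true true true
  | .om3g => triangle .up .down .down true true false
  | .om3h => triangle .up .down .up true true true
  | .om4a => vertexSlide .up .up false
  | .om4b => vertexSlide .up .down false
  | .om4c => vertexSlide .up .up true
  | .om4d => vertexSlide .up .down true
  | .om4e => vertexSlide .down .up false
  | .om4f => vertexSlide .down .down false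
  | .om4g => vertexSlide .down .up true
  | .om4h => vertexSlide .down .down true
  | .om5a => vertexTwist .up true
  | .om5b => vertexTwist .up false
  | .om5c => vertexTwist .down true
  | .om5d => vertexTwist .down false

/-! ### Generating sets -/

/-- The local replacements available for a set `S` of moves: elementary planar isotopies, and the
moves in `S`. -/
inductive LocalChange (S : Finset Move) : List Slice → List Slice → Prop where
  | isotopy {u v : List Slice} (h : Isotopy u v) : LocalChange S u v
  | move (m : Move) (hm : m ∈ S) : LocalChange S m.pair.lhs.slices m.pair.rhs.slices

/-- Two diagrams in the same rectangle differ by one local replacement in a smaller rectangle, and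
agree outside it. -/
def Step (S : Finset Move) {p q : List Dir} (D D' : Diagram p q) : Prop :=
  ∃ (u v below above : List Slice) (l r : List Dir), LocalChange S u v ∧
    D.slices = below ++ pad l r u ++ above ∧ D'.slices = below ++ pad l r v ++ above

/-- The move `m` is realized by `S`: inside the disk of `m`, one passes from one side of `m` to the
other by finitely many planar isotopies and moves in `S`, each used in either direction. -/
def Realizes (S : Finset Move) (m : Move) : Prop :=
  Relation.EqvGen (Step S) m.pair.lhs m.pair.rhs

/-- `S` is a generating set: it realizes all 28 moves. -/
def IsGenerating (S : Finset Move) : Prop := ∀ m : Move, Realizes S m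

/-- `S` is a minimal generating set: no generating set has fewer elements. -/
def IsMinimalGenerating (S : Finset Move) : Prop :=
  IsGenerating S ∧ ∀ R : Finset Move, IsGenerating R → S.card ≤ R.card

/-- The four moves of type 2. -/
def omega2 : Finset Move := {.om2a, .om2b, .om2c, .om2d}

/-- The eight moves of type 4. -/
def omega4 : Finset Move := {.om4a, .om4b, .om4c, .om4d, .om4e, .om4f, .om4g, .om4h}

/-- The four pairs of moves of type 4. -/
def omega4Pairs : List (Finset Move) :=
  [{.om4a, .om4b}, {.om4c, .om4d}, {.om4e, .om4f}, {.om4g, .om4h}]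

end TrivalentDiagram

open TrivalentDiagram

/-! Necessity comes from a colouring invariant for each of the four pairs, that is, for each type
`d₀` of vertex and each choice `o₀` of over or under. Strands are coloured by a three-element
quandle whose element `2` swaps `0` and `1` and whose other elements act trivially. The strand whose
colour changes at a crossing is the one that plays the part of the sliding strand. Vertices of type
`d₀` impose no condition; at the others an even number of legs has colour `2`, so that two legs
together act like the third. The relation between the colours at the bottom and at the top then
survives planar isotopy and all moves outside the chosen pair, but neither move in it
(`sameColourings_of_notMem_slides`, `not_sameColourings_of_mem_slides`). Hence every generating set
meets every pair.

The two moves of a pair differ only in the direction of the sliding strand. Planar rotation turns a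
slide into one of the reversed strand in which one crossing is exchanged for two at other legs;
inserting a bigon first brings this to the required form (`Equivalent.slide_flip`). So one move of a
pair yields the other with the help of the Ω2 moves.

For minimality, Ω2 relates diagrams without vertices, and vertices cannot appear along a sequence of
moves that starts without them. A generating set therefore realizes Ω2 without any Ω4 move
(`Realizes.sdiff_omega4`). If it contains both moves of a pair, one of them can be dropped; and its
Ω4 moves can be exchanged for any choice of one from each pair without changing the cardinality. -/

namespace TrivalentDiagram

/-! ### Stacks of slices -/

theorem isStack_append {p q : List Dir} {u v : List Slice} :
    IsStack p (u ++ v) q ↔ ∃ m, IsStack p u m ∧ IsStack m v q := by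
  induction u generalizing p with
  | nil => simp [IsStack]
  | cons s u ih => simp [IsStack, ih, and_assoc]

theorem IsStack.append {p m q : List Dir} {u v : List Slice} (hu : IsStack p u m)
    (hv : IsStack m v q) : IsStack p (u ++ v) q :=
  isStack_append.2 ⟨m, hu, hv⟩

theorem IsStack.pad {p q : List Dir} {w : List Slice} (l r : List Dir) (h : IsStack p w q) :
    IsStack (l ++ p ++ r) (pad l r w) (l ++ q ++ r) := by
  induction w generalizing p with
  | nil =>
    cases h
    rfl
  | cons s w ih =>
    obtain ⟨rfl, h⟩ := h
    refine ⟨by simp [Slice.bottom], ?_⟩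
    have := ih h
    simpa [Slice.top, TrivalentDiagram.pad] using this

theorem IsStack.top_unique {p q q' : List Dir} {w : List Slice} (h : IsStack p w q)
    (h' : IsStack p w q') : q = q' := by
  induction w generalizing p with
  | nil => exact h.symm.trans h'
  | cons s w ih => exact ih h.2 h'.2

/-- The first slice records its bottom end points. An empty stack fits any family of strands and
must be excluded. -/
theorem IsStack.bottom_unique {p p' q q' : List Dir} {w : List Slice} (hw : w ≠ [])
    (h : IsStack p w q) (h' : IsStack p' w q') : p = p' := by
  cases w with
  | nil => exact absurd rfl hw
  | cons s w => exact h.1.trans h'.1.symm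

instance decidableIsStack : ∀ (p : List Dir) (w : List Slice) (q : List Dir),
    Decidable (IsStack p w q)
  | p, [], q => inferInstanceAs (Decidable (p = q))
  | p, s :: w, q =>
    have := decidableIsStack s.top w q
    inferInstanceAs (Decidable (p = s.bottom ∧ IsStack s.top w q))

theorem pad_append (l r : List Dir) (u v : List Slice) :
    pad l r (u ++ v) = pad l r u ++ pad l r v :=
  List.map_append

theorem pad_pad (l r l' r' : List Dir) (w : List Slice) :
    pad l r (pad l' r' w) = pad (l ++ l') (r' ++ r) w := by
  simp [pad]

/-- The strands next to a smaller rectangle that contains a nonempty stack are determined. -/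
theorem IsStack.of_context {p q b t l r : List Dir} {below above w : List Slice} (hw : w ≠ [])
    (hbt : IsStack b w t) (h : IsStack p (below ++ TrivalentDiagram.pad l r w ++ above) q) :
    IsStack p below (l ++ b ++ r) ∧ IsStack (l ++ t ++ r) above q := by
  obtain ⟨m, h, ha⟩ := isStack_append.1 h
  obtain ⟨n, hb, h⟩ := isStack_append.1 h
  have hn : n = l ++ b ++ r := h.bottom_unique (by simpa [TrivalentDiagram.pad] using hw) (hbt.pad l r)
  subst hn
  exact ⟨hb, (h.top_unique (hbt.pad l r)) ▸ ha⟩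

theorem Dir.flip_flip (a : Dir) : a.flip.flip = a := by
  cases a <;> rfl

theorem Isotopy.isStack {u v : List Slice} (h : Isotopy u v) :
    ∃ b t, IsStack b u t ∧ IsStack b v t ∧ u ≠ [] := by
  cases h with
  | zigzagLeft a => exact ⟨[a], [a], by cases a <;> decide, rfl, by simp⟩
  | zigzagRight a => exact ⟨[a], [a], by cases a <;> decide, rfl, by simp⟩
  | turnCross a b o =>
    exact ⟨[a, b], [b, a], ⟨rfl, rfl⟩, by cases a <;> cases b <;> cases o <;> decide, by simp⟩
  | turnVertex a =>
    exact ⟨[a], [a.flip, a.flip], ⟨rfl, rfl⟩, by cases a <;> decide, by simp⟩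
  | exchange g h m =>
    exact ⟨g.bottom ++ m ++ h.bottom, g.top ++ m ++ h.top,
      by simp [IsStack, Slice.bottom, Slice.top], by simp [IsStack, Slice.bottom, Slice.top],
      by simp⟩

/-- Both sides of a local replacement are stacks in the same rectangle, and one of them is nonempty. -/
theorem LocalChange.isStack {S : Finset Move} {u v : List Slice} (h : LocalChange S u v) :
    ∃ b t, IsStack b u t ∧ IsStack b v t ∧ (u ≠ [] ∨ v ≠ []) := by
  cases h with
  | isotopy h =>
    obtain ⟨b, t, hu, hv, hne⟩ := h.isStack
    exact ⟨b, t, hu, hv, .inl hne⟩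
  | move m hm =>
    exact ⟨_, _, m.pair.lhs.isStack, m.pair.rhs.isStack,
      .inr (by cases m <;> exact List.cons_ne_nil _ _)⟩

/-- One side of a local replacement may be empty, as for a zigzag, a curl or a bigon. The nonempty
side fixes the strands at the boundary of the smaller rectangle, and hence those of the other side.
-/
theorem LocalChange.context {S : Finset Move} {u v below above : List Slice}
    {p q l r : List Dir} (h : LocalChange S u v)
    (hu : IsStack p (below ++ pad l r u ++ above) q)
    (hv : IsStack p (below ++ pad l r v ++ above) q) :
    ∃ b t, IsStack b u t ∧ IsStack b v t ∧ IsStack p below (l ++ b ++ r) ∧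
      IsStack (l ++ t ++ r) above q := by
  obtain ⟨b, t, hbu, hbv, hne⟩ := h.isStack
  rcases hne with hne | hne
  · exact ⟨b, t, hbu, hbv, hbu.of_context hne hu⟩
  · exact ⟨b, t, hbu, hbv, hbv.of_context hne hv⟩

/-! ### Equivalence of stacks -/

/-- The stacks `u` and `v` are diagrams with end points `p` and `q` that are related by planar
isotopies and moves in `S`. -/
def Equivalent (S : Finset Move) (p q : List Dir) (u v : List Slice) : Prop :=
  ∃ (hu : IsStack p u q) (hv : IsStack p v q),
    Relation.EqvGen (Step S) (⟨u, hu⟩ : Diagram p q) ⟨v, hv⟩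

variable {S : Finset Move} {p q : List Dir} {u v w : List Slice}

theorem Equivalent.refl (h : IsStack p u q) : Equivalent S p q u u :=
  ⟨h, h, .refl _⟩

theorem Equivalent.symm (h : Equivalent S p q u v) : Equivalent S p q v u :=
  let ⟨hu, hv, e⟩ := h
  ⟨hv, hu, e.symm⟩

theorem Equivalent.trans (h : Equivalent S p q u v) (h' : Equivalent S p q v w) :
    Equivalent S p q u w :=
  let ⟨hu, _, e⟩ := h
  let ⟨_, hw, e'⟩ := h'
  ⟨hu, hw, .trans _ _ _ e e'⟩

instance : Trans (Equivalent S p q) (Equivalent S p q) (Equivalent S p q) :=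
  ⟨Equivalent.trans⟩

theorem LocalChange.equivalent (h : LocalChange S u v) (hu : IsStack p u q)
    (hv : IsStack p v q) : Equivalent S p q u v :=
  ⟨hu, hv, .rel _ _ ⟨u, v, [], [], [], [], h, by simp [pad], by simp [pad]⟩⟩

theorem equivalent_of_eqvGen {D D' : Diagram p q} (h : Relation.EqvGen (Step S) D D') :
    Equivalent S p q D.slices D'.slices :=
  ⟨D.isStack, D'.isStack, h⟩

theorem eqvGen_of_equivalent {D D' : Diagram p q} (h : Equivalent S p q D.slices D'.slices) :
    Relation.EqvGen (Step S) D D' :=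
  let ⟨_, _, e⟩ := h
  e

/-- Equivalence inside a smaller rectangle. -/
theorem Equivalent.context {b t : List Dir} (l r : List Dir) {below above : List Slice}
    (h : Equivalent S b t u v) (hb : IsStack p below (l ++ b ++ r))
    (ha : IsStack (l ++ t ++ r) above q) :
    Equivalent S p q (below ++ pad l r u ++ above) (below ++ pad l r v ++ above) := by
  obtain ⟨hu, hv, e⟩ := h
  have key : ∀ D D' : Diagram b t, Relation.EqvGen (Step S) D D' →
      Equivalent S p q (below ++ pad l r D.slices ++ above)
        (below ++ pad l r D'.slices ++ above) := by
    intro D D' e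
    induction e with
    | rel D D' h =>
      obtain ⟨u, v, below', above', l', r', h, hD, hD'⟩ := h
      refine ⟨(hb.append (D.isStack.pad l r)).append ha,
        (hb.append (D'.isStack.pad l r)).append ha, .rel _ _ ?_⟩
      refine ⟨u, v, below ++ pad l r below', pad l r above' ++ above, l ++ l', r' ++ r, h, ?_, ?_⟩
      · simp [hD, pad_append, pad_pad]
      · simp [hD', pad_append, pad_pad]
    | refl D => exact .refl ((hb.append (D.isStack.pad l r)).append ha)
    | symm _ _ _ ih => exact ih.symm
    | trans _ _ _ _ _ ih ih' => exact ih.trans ih'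
  exact key _ _ e

/-- Replacement of the part `u` of the stack `U` that begins at height `i`, has `l` on its left
and `r` on its right. -/
theorem Equivalent.replace {b t : List Dir} {U V : List Slice} (i : ℕ) (l r : List Dir)
    (h : Equivalent S b t u v)
    -- For explicit stacks the fitting conditions and both decompositions are list computations, so
    -- a rewriting step has to supply only the position and the local equivalence.
    (hb : IsStack p (U.take i) (l ++ b ++ r) := by
      simp [IsStack, Slice.bottom, Slice.top, Piece.bottom, Piece.top, Dir.flip_flip])
    (ha : IsStack (l ++ t ++ r) (U.drop (i + u.length)) q := by
      simp [IsStack, Slice.bottom, Slice.top, Piece.bottom, Piece.top, Dir.flip_flip])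
    (hU : U = U.take i ++ pad l r u ++ U.drop (i + u.length) := by
      simp [pad, Piece.bottom, Piece.top, Dir.flip_flip])
    (hV : V = U.take i ++ pad l r v ++ U.drop (i + u.length) := by
      simp [pad, Piece.bottom, Piece.top, Dir.flip_flip]) :
    Equivalent S p q U V := by
  have := h.context l r hb ha
  rwa [← hU, ← hV] at this

/-- A move in `S` that realizes the elements of `R` realizes what `R` realizes. -/
theorem Realizes.trans {R : Finset Move} {m : Move} (h : Realizes R m)
    (hS : ∀ x ∈ R, Realizes S x) : Realizes S m := by
  have key : ∀ D D' : Diagram m.pair.bottom m.pair.top, Relation.EqvGen (Step R) D D' →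
      Equivalent S m.pair.bottom m.pair.top D.slices D'.slices := by
    intro D D' e
    induction e with
    | rel D D' h =>
      obtain ⟨u, v, below, above, l, r, h, hD, hD'⟩ := h
      have hcu := hD ▸ D.isStack
      have hcv := hD' ▸ D'.isStack
      rw [hD, hD']
      cases h with
      | isotopy h =>
        obtain ⟨b, t, hu, hv, hb, ha⟩ := (LocalChange.isotopy (S := S) h).context hcu hcv
        exact ((LocalChange.isotopy h).equivalent hu hv).context l r hb ha
      | move x hx =>
        -- The left side is empty for Ω1 and Ω2, so the right side is used to locate the rectangle.
        have hne : x.pair.rhs.slices ≠ [] := by cases x <;> exact List.cons_ne_nil _ _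
        obtain ⟨hb, ha⟩ := x.pair.rhs.isStack.of_context hne hcv
        exact (equivalent_of_eqvGen (hS x hx)).context l r hb ha
    | refl D => exact .refl D.isStack
    | symm _ _ _ ih => exact ih.symm
    | trans _ _ _ _ _ ih ih' => exact ih.trans ih'
  exact eqvGen_of_equivalent (key _ _ h)

theorem realizes_of_mem {m : Move} (h : m ∈ S) : Realizes S m :=
  eqvGen_of_equivalent ((LocalChange.move m h).equivalent m.pair.lhs.isStack m.pair.rhs.isStack)

theorem Realizes.mono {R : Finset Move} {m : Move} (h : Realizes R m) (hRS : R ⊆ S) :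
    Realizes S m :=
  h.trans fun _ hx => realizes_of_mem (hRS hx)

end TrivalentDiagram

namespace TrivalentDiagram

/-! ### Colourings

Every set of moves without a slide of a strand over (or under) a source (or a sink) preserves a
colouring invariant. The colours form a quandle with three elements, in which `2` exchanges `0` and
`1`. -/

/-- The action of the colour `y` on the colour `x`. -/
def colourAct (y x : Fin 3) : Fin 3 :=
  if y = 2 then (if x = 0 then 1 else if x = 1 then 0 else 2) else x

/-- The colourings of the top of a piece that extend a given colouring of its bottom. If `o₀` is
`false`, colours change at undercrossings, otherwise at overcrossings. Colours are arbitrary at a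
vertex of type `d₀`; at the other vertices, the number of legs of colour `2` is even. -/
def pieceColourings (d₀ : Dir) (o₀ : Bool) : Piece → List (Fin 3) → List (List (Fin 3))
  | .cup _, [] => [[0, 0], [1, 1], [2, 2]]
  | .cap _, [x, y] => if x = y then [[]] else []
  | .cross _ _ o, [x, y] => if o = o₀ then [[y, colourAct y x]] else [[colourAct x y, x]]
  | .vertex d, [x] =>
    [[0, 0], [0, 1], [0, 2], [1, 0], [1, 1], [1, 2], [2, 0], [2, 1], [2, 2]].filter fun t =>
      d = d₀ ∨ Even ((x :: t).count 2)
  | _, _ => []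

/-- The colourings of the top of a slice that extend a given colouring of its bottom. -/
def sliceColourings (d₀ : Dir) (o₀ : Bool) (s : Slice) (L : List (Fin 3)) : List (List (Fin 3)) :=
  (pieceColourings d₀ o₀ s.piece ((L.drop s.left.length).take s.piece.bottom.length)).map fun t =>
    L.take s.left.length ++ t ++ (L.drop s.left.length).drop s.piece.bottom.length

/-- The colourings of the top of a stack that extend a given colouring of its bottom. -/
def colourings (d₀ : Dir) (o₀ : Bool) : List Slice → List (Fin 3) → List (List (Fin 3))
  | [], L => [L]
  | s :: w, L => (sliceColourings d₀ o₀ s L).flatMap (colourings d₀ o₀ w)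

variable {d₀ : Dir} {o₀ : Bool}

/-! ### Locality of colourings -/

theorem length_of_mem_pieceColourings {g : Piece} {L t : List (Fin 3)}
    (h : t ∈ pieceColourings d₀ o₀ g L) : t.length = g.top.length := by
  unfold pieceColourings at h
  split at h
  · simp only [List.mem_cons, List.not_mem_nil, or_false] at h
    rcases h with rfl | rfl | rfl <;> rfl
  · split_ifs at h <;> simp_all [Piece.top]
  · split_ifs at h <;> simp_all [Piece.top]
  · have := List.mem_of_mem_filter h
    simp only [List.mem_cons, List.not_mem_nil, or_false] at this
    rcases this with rfl | rfl | rfl | rfl | rfl | rfl | rfl | rfl | rfl <;> rfl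
  · simp at h

theorem sliceColourings_append {l r : List Dir} {g : Piece} {a b c : List (Fin 3)}
    (ha : a.length = l.length) (hb : b.length = g.bottom.length) :
    sliceColourings d₀ o₀ ⟨l, g, r⟩ (a ++ b ++ c) =
      (pieceColourings d₀ o₀ g b).map fun t => a ++ t ++ c := by
  simp [sliceColourings, ← ha, ← hb]

/-- A colouring of three adjacent families of strands. -/
theorem exists_split {l p r : List Dir} {L : List (Fin 3)} (h : L.length = (l ++ p ++ r).length) :
    ∃ a b c, L = a ++ b ++ c ∧ a.length = l.length ∧ b.length = p.length ∧
      c.length = r.length := by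
  simp only [List.length_append] at h
  refine ⟨L.take l.length, (L.drop l.length).take p.length, (L.drop l.length).drop p.length,
    by simp only [List.append_assoc, List.take_append_drop], ?_, ?_, ?_⟩ <;>
  simp <;> omega

theorem length_of_mem_colourings {p q : List Dir} {w : List Slice} {L M : List (Fin 3)}
    (hw : IsStack p w q) (hL : L.length = p.length) (hM : M ∈ colourings d₀ o₀ w L) :
    M.length = q.length := by
  induction w generalizing p L with
  | nil =>
    cases hw
    simp only [colourings, List.mem_singleton] at hM
    rw [hM, hL]
  | cons s w ih =>
    obtain ⟨rfl, hw⟩ := hw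
    obtain ⟨a, b, c, rfl, ha, hb, hc⟩ := exists_split hL
    obtain ⟨N, hN, hM⟩ := List.mem_flatMap.1 hM
    refine ih hw ?_ hM
    rw [sliceColourings_append (l := s.left) (r := s.right) ha hb] at hN
    obtain ⟨t, ht, rfl⟩ := List.mem_map.1 hN
    simp [Slice.top, ha, hc, length_of_mem_pieceColourings ht]

theorem mem_colourings_append {u v : List Slice} {L N : List (Fin 3)} :
    N ∈ colourings d₀ o₀ (u ++ v) L ↔
      ∃ M ∈ colourings d₀ o₀ u L, N ∈ colourings d₀ o₀ v M := by
  induction u generalizing L with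
  | nil => simp [colourings]
  | cons s u ih =>
    simp only [List.cons_append, colourings, List.mem_flatMap, ih]
    exact ⟨fun ⟨K, hK, M, hM, hN⟩ => ⟨M, ⟨K, hK, hM⟩, hN⟩,
      fun ⟨M, ⟨K, hK, hM⟩, hN⟩ => ⟨K, hK, M, hM, hN⟩⟩

/-- Each slice acts only on the colours of the strands that enter its piece, so the strands beside
the smaller rectangle carry their colours along unchanged. -/
theorem colourings_pad {p q l r : List Dir} {w : List Slice} {a b c : List (Fin 3)}
    (hw : IsStack p w q) (ha : a.length = l.length) (hb : b.length = p.length) :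
    colourings d₀ o₀ (pad l r w) (a ++ b ++ c) =
      (colourings d₀ o₀ w b).map fun t => a ++ t ++ c := by
  induction w generalizing p b with
  | nil => rfl
  | cons s w ih =>
    obtain ⟨rfl, hw⟩ := hw
    obtain ⟨a', b', c', rfl, ha', hb', hc'⟩ := exists_split hb
    have h1 : a ++ (a' ++ b' ++ c') ++ c = (a ++ a') ++ b' ++ (c' ++ c) := by simp
    have h2 := sliceColourings_append (d₀ := d₀) (o₀ := o₀) (l := s.left) (r := s.right)
      (c := c') ha' hb'
    have h3 := sliceColourings_append (d₀ := d₀) (o₀ := o₀) (l := l ++ s.left)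
      (r := s.right ++ r) (g := s.piece) (a := a ++ a') (c := c' ++ c) (by simp [ha, ha']) hb'
    change List.flatMap _ _ = List.map _ (List.flatMap _ _)
    rw [h1, h3, h2, List.flatMap_map, List.flatMap_map, List.map_flatMap]
    refine List.flatMap_congr fun t ht => ?_
    have := ih (b := a' ++ t ++ c') hw
      (by simp [Slice.top, ha', hc', length_of_mem_pieceColourings ht])
    simpa [pad] using this

/-- The two stacks have the same colourings with given end points. -/
def SameColourings (d₀ : Dir) (o₀ : Bool) (p : List Dir) (u v : List Slice) : Prop :=
  ∀ L : List (Fin 3), L.length = p.length →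
    ∀ M, M ∈ colourings d₀ o₀ u L ↔ M ∈ colourings d₀ o₀ v L

/-! ### Invariance of colourings -/

/-- Functions on `Fin p.length` form a finite type, which makes the comparison of two concrete
stacks decidable. -/
theorem sameColourings_iff_vector {p : List Dir} {u v : List Slice} :
    SameColourings d₀ o₀ p u v ↔ ∀ f : Fin p.length → Fin 3,
      colourings d₀ o₀ u (List.ofFn f) ⊆ colourings d₀ o₀ v (List.ofFn f) ∧
      colourings d₀ o₀ v (List.ofFn f) ⊆ colourings d₀ o₀ u (List.ofFn f) := by
  constructor
  · intro h f
    exact ⟨fun M => (h _ (by simp) M).1, fun M => (h _ (by simp) M).2⟩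
  · intro h L hL M
    have h' := h fun i => L.get (i.cast hL.symm)
    have e : (List.ofFn fun i : Fin p.length => L.get (i.cast hL.symm)) = L := by
      refine List.ext_getElem (by simp [hL]) ?_
      intro i _ _
      simp
    rw [e] at h'
    exact ⟨fun hM => h'.1 hM, fun hM => h'.2 hM⟩

instance (p : List Dir) (u v : List Slice) : Decidable (SameColourings d₀ o₀ p u v) :=
  decidable_of_iff' _ sameColourings_iff_vector

/-- Colourings of a stack compose as relations, with existentially quantified colours at
intermediate levels, so a part may be replaced by another with the same relation. Multiplicities are
ignored. -/
theorem SameColourings.context {p b t l r : List Dir} {u v below above : List Slice}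
    (h : SameColourings d₀ o₀ b u v) (hu : IsStack b u t) (hv : IsStack b v t)
    (hb : IsStack p below (l ++ b ++ r)) :
    SameColourings d₀ o₀ p (below ++ pad l r u ++ above) (below ++ pad l r v ++ above) := by
  intro L hL N
  simp only [List.append_assoc, mem_colourings_append]
  refine exists_congr fun K => and_congr_right fun hK => exists_congr fun M =>
    and_congr_left fun _ => ?_
  obtain ⟨x, y, z, rfl, hx, hy, hz⟩ := exists_split (length_of_mem_colourings hb hL hK)
  simp only [colourings_pad hu hx hy, colourings_pad hv hx hy, List.mem_map, h y hy]

/-- The two pieces act on disjoint blocks of colours, so their choices are independent. A general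
argument is needed because `m` is arbitrary; the other isotopies are finite checks. -/
theorem sameColourings_exchange (g h : Piece) (m : List Dir) :
    SameColourings d₀ o₀ (g.bottom ++ m ++ h.bottom)
      [⟨[], g, m ++ h.bottom⟩, ⟨g.top ++ m, h, []⟩]
      [⟨g.bottom ++ m, h, []⟩, ⟨[], g, m ++ h.top⟩] := by
  intro L hL M
  obtain ⟨x, y, z, rfl, hx, hy, hz⟩ := exists_split hL
  have h1 := sliceColourings_append (d₀ := d₀) (o₀ := o₀) (l := []) (r := m ++ h.bottom) (g := g)
    (a := []) (b := x) (c := y ++ z) rfl hx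
  have h2 := sliceColourings_append (d₀ := d₀) (o₀ := o₀) (l := g.bottom ++ m) (r := []) (g := h)
    (a := x ++ y) (b := z) (c := []) (by simp [hx, hy]) hz
  have h3 : ∀ t ∈ pieceColourings d₀ o₀ g x,
      sliceColourings d₀ o₀ ⟨g.top ++ m, h, []⟩ (t ++ (y ++ z)) =
        (pieceColourings d₀ o₀ h z).map fun s => t ++ y ++ s := fun t ht => by
    simpa using sliceColourings_append (d₀ := d₀) (o₀ := o₀) (l := g.top ++ m) (r := []) (g := h)
      (a := t ++ y) (b := z) (c := []) (by simp [length_of_mem_pieceColourings ht, hy]) hz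
  have h4 : ∀ s, sliceColourings d₀ o₀ ⟨[], g, m ++ h.top⟩ (x ++ (y ++ s)) =
        (pieceColourings d₀ o₀ g x).map fun t => t ++ y ++ s := fun s => by
    simpa using sliceColourings_append (d₀ := d₀) (o₀ := o₀) (l := []) (r := m ++ h.top) (g := g)
      (a := []) (b := x) (c := y ++ s) rfl hx
  simp only [List.nil_append, List.append_nil, List.append_assoc] at h1 h2
  simp only [colourings, List.append_assoc, h1, h2, List.mem_flatMap, List.mem_map,
    List.mem_singleton]
  constructor
  · rintro ⟨_, ⟨t, ht, rfl⟩, N, hN, rfl⟩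
    rw [h3 t ht] at hN
    obtain ⟨s, hs, rfl⟩ := List.mem_map.1 hN
    exact ⟨_, ⟨s, hs, rfl⟩, _, by rw [h4 s]; exact List.mem_map_of_mem ht, rfl⟩
  · rintro ⟨_, ⟨s, hs, rfl⟩, N, hN, rfl⟩
    rw [h4 s] at hN
    obtain ⟨t, ht, rfl⟩ := List.mem_map.1 hN
    exact ⟨_, ⟨t, ht, rfl⟩, _, by rw [h3 t ht]; exact List.mem_map_of_mem hs, rfl⟩

theorem Isotopy.sameColourings {u v : List Slice} {b t : List Dir} (h : Isotopy u v)
    (hu : IsStack b u t) : SameColourings d₀ o₀ b u v := by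
  cases h with
  | zigzagLeft a =>
    obtain ⟨rfl, -⟩ := hu
    cases d₀ <;> cases o₀ <;> cases a <;> decide
  | zigzagRight a =>
    obtain ⟨rfl, -⟩ := hu
    cases d₀ <;> cases o₀ <;> cases a <;> decide
  | turnCross a b o =>
    obtain ⟨rfl, -⟩ := hu
    cases d₀ <;> cases o₀ <;> cases a <;> cases b <;> cases o <;> decide +kernel
  | turnVertex a =>
    obtain ⟨rfl, -⟩ := hu
    cases d₀ <;> cases o₀ <;> cases a <;> decide +kernel
  | exchange g h m =>
    obtain ⟨rfl, -⟩ := hu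
    simpa [Slice.bottom] using sameColourings_exchange g h m

/-- The slides of a strand over (`o₀ = true`) or under (`o₀ = false`) a vertex of type `d₀`. -/
def slides : Dir → Bool → Finset Move
  | .up, false => {.om4a, .om4b}
  | .up, true => {.om4c, .om4d}
  | .down, false => {.om4e, .om4f}
  | .down, true => {.om4g, .om4h}

/-- All moves preserve the colouring invariant, except for the slides over (`o₀ = true`) or under
(`o₀ = false`) a vertex of type `d₀`. -/
theorem sameColourings_of_notMem_slides {m : Move} (hm : m ∉ slides d₀ o₀) :
    SameColourings d₀ o₀ m.pair.bottom m.pair.lhs.slices m.pair.rhs.slices := by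
  cases d₀ <;> cases o₀ <;> cases m <;>
    -- A finite check. Ω1, Ω2 and Ω3 are the quandle axioms, with an action by involutions that
    -- makes orientations irrelevant. Ω5 permutes the colour pairs of the upper legs and keeps the
    -- number of `2`s. Of the remaining slides, in some the strand acts on all legs by one
    -- automorphism that fixes `2`; in the others it is acted on, and parity at the vertex makes
    -- both sides agree.
    first
    | exact absurd (by decide) hm
    | decide +kernel

/-- With no condition at the vertex, take colour `0` on the strand, `2` on the lower leg and `0` on
the upper legs: the strand leaves with colour `1` on one side of the move and `0` on the other. -/
theorem not_sameColourings_of_mem_slides {m : Move} (hm : m ∈ slides d₀ o₀) :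
    ¬ SameColourings d₀ o₀ m.pair.bottom m.pair.lhs.slices m.pair.rhs.slices := by
  cases d₀ <;> cases o₀ <;> cases m <;>
    first
    | exact absurd hm (by decide)
    | decide +kernel

/-- A slide across a vertex is realized only with slides of the same kind. -/
theorem Realizes.inter_slides_nonempty {S : Finset Move} {m : Move} (h : Realizes S m)
    (hm : m ∈ slides d₀ o₀) : (S ∩ slides d₀ o₀).Nonempty := by
  by_contra hS
  rw [Finset.not_nonempty_iff_eq_empty, ← Finset.disjoint_iff_inter_eq_empty,
    Finset.disjoint_left] at hS
  have key : ∀ D D' : Diagram m.pair.bottom m.pair.top, Relation.EqvGen (Step S) D D' →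
      SameColourings d₀ o₀ m.pair.bottom D.slices D'.slices := by
    intro D D' e
    induction e with
    | rel D D' h =>
      obtain ⟨u, v, below, above, l, r, h, hD, hD'⟩ := h
      obtain ⟨b, t, hu, hv, hb, ha⟩ := h.context (hD ▸ D.isStack) (hD' ▸ D'.isStack)
      rw [hD, hD']
      cases h with
      | isotopy h => exact (h.sameColourings hu).context hu hv hb
      | move x hx =>
        have hne : x.pair.rhs.slices ≠ [] := by cases x <;> exact List.cons_ne_nil _ _
        obtain rfl := hv.bottom_unique hne x.pair.rhs.isStack
        exact (sameColourings_of_notMem_slides (hS hx)).context hu hv hb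
    | refl D => exact fun _ _ _ => Iff.rfl
    | symm _ _ _ ih => exact fun L hL M => (ih L hL M).symm
    | trans _ _ _ _ _ ih ih' => exact fun L hL M => (ih L hL M).trans (ih' L hL M)
  exact not_sameColourings_of_mem_slides hm (key _ _ h)

end TrivalentDiagram

namespace TrivalentDiagram

/-! ### Turning crossings and sliding strands across vertices -/

variable {S : Finset Move}

theorem equivalent_zigzagLeft (a : Dir) :
    Equivalent S [a] [a] [⟨[a], .cup a.flip, []⟩, ⟨[], .cap a, [a]⟩] [] :=
  (LocalChange.isotopy (.zigzagLeft a)).equivalent (by cases a <;> decide) rfl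

theorem equivalent_zigzagRight (a : Dir) :
    Equivalent S [a] [a] [⟨[], .cup a, [a]⟩, ⟨[a], .cap a.flip, []⟩] [] :=
  (LocalChange.isotopy (.zigzagRight a)).equivalent (by cases a <;> decide) rfl

theorem equivalent_turnCross (a b : Dir) (o : Bool) :
    Equivalent S [a, b] [b, a] [⟨[], .cross a b o, []⟩]
      [⟨[], .cup b, [a, b]⟩, ⟨[b], .cross b.flip a (!o), [b]⟩, ⟨[b, a], .cap b.flip, []⟩] :=
  (LocalChange.isotopy (.turnCross a b o)).equivalent ⟨rfl, rfl⟩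
    (by cases a <;> cases b <;> cases o <;> decide)

theorem equivalent_turnVertex (a : Dir) :
    Equivalent S [a] [a.flip, a.flip] [⟨[], .vertex a, []⟩]
      [⟨[], .cup a.flip, [a]⟩, ⟨[a.flip], .vertex a, [a]⟩,
        ⟨[a.flip, a.flip], .cap a.flip, []⟩] :=
  (LocalChange.isotopy (.turnVertex a)).equivalent ⟨rfl, rfl⟩ (by cases a <;> decide)

theorem equivalent_exchange (g h : Piece) (m : List Dir) :
    Equivalent S (g.bottom ++ m ++ h.bottom) (g.top ++ m ++ h.top)
      [⟨[], g, m ++ h.bottom⟩, ⟨g.top ++ m, h, []⟩]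
      [⟨g.bottom ++ m, h, []⟩, ⟨[], g, m ++ h.top⟩] :=
  (LocalChange.isotopy (.exchange g h m)).equivalent
    (by simp [IsStack, Slice.bottom, Slice.top]) (by simp [IsStack, Slice.bottom, Slice.top])

/-- A crossing next to a minimum is moved from one of its ends to the other. -/
theorem equivalent_cup_cross (x y : Dir) (o : Bool) :
    Equivalent S [x] [y, x, y.flip]
      [⟨[x], .cup y, []⟩, ⟨[], .cross x y o, [y.flip]⟩]
      [⟨[], .cup y, [x]⟩, ⟨[y], .cross y.flip x (!o), []⟩] := by
  calc
    Equivalent S [x] [y, x, y.flip]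
        [⟨[x], .cup y, []⟩, ⟨[], .cross x y o, [y.flip]⟩]
        [⟨[x], .cup y, []⟩, ⟨[], .cup y, [x, y, y.flip]⟩,
        ⟨[y], .cross y.flip x (!o), [y, y.flip]⟩, ⟨[y, x], .cap y.flip, [y.flip]⟩] :=
      .replace 1 [] [y.flip] (equivalent_turnCross x y o)
    Equivalent S [x] [y, x, y.flip] _
        [⟨[], .cup y, [x]⟩, ⟨[y, y.flip, x], .cup y, []⟩,
        ⟨[y], .cross y.flip x (!o), [y, y.flip]⟩, ⟨[y, x], .cap y.flip, [y.flip]⟩] :=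
      .replace 0 [] [] (equivalent_exchange (.cup y) (.cup y) [x]).symm
    Equivalent S [x] [y, x, y.flip] _
        [⟨[], .cup y, [x]⟩, ⟨[y], .cross y.flip x (!o), []⟩, ⟨[y, x, y.flip], .cup y, []⟩,
        ⟨[y, x], .cap y.flip, [y.flip]⟩] :=
      .replace 1 [y] [] (equivalent_exchange (.cross y.flip x (!o)) (.cup y) []).symm
    Equivalent S [x] [y, x, y.flip] _
        [⟨[], .cup y, [x]⟩, ⟨[y], .cross y.flip x (!o), []⟩] :=
      .replace 2 [y, x] [] (equivalent_zigzagLeft y.flip)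

/-- A crossing next to a maximum is moved from one of its ends to the other. -/
theorem equivalent_cross_cap (x y : Dir) (o : Bool) :
    Equivalent S [x, y, x.flip] [y]
      [⟨[x], .cross y x.flip (!o), []⟩, ⟨[], .cap x, [y]⟩]
      [⟨[], .cross x y o, [x.flip]⟩, ⟨[y], .cap x, []⟩] := by
  calc
    Equivalent S [x, y, x.flip] [y]
        [⟨[x], .cross y x.flip (!o), []⟩, ⟨[], .cap x, [y]⟩]
        [⟨[x], .cup x.flip, [y, x.flip]⟩, ⟨[x, x.flip], .cross x y o, [x.flip]⟩,
        ⟨[x, x.flip, y], .cap x, []⟩, ⟨[], .cap x, [y]⟩] :=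
      .replace 0 [x] [] (equivalent_turnCross y x.flip (!o))
    Equivalent S [x, y, x.flip] [y] _
        [⟨[x], .cup x.flip, [y, x.flip]⟩, ⟨[x, x.flip], .cross x y o, [x.flip]⟩,
        ⟨[], .cap x, [y, x, x.flip]⟩, ⟨[y], .cap x, []⟩] :=
      .replace 2 [] [] (equivalent_exchange (.cap x) (.cap x) [y]).symm
    Equivalent S [x, y, x.flip] [y] _
        [⟨[x], .cup x.flip, [y, x.flip]⟩, ⟨[], .cap x, [x, y, x.flip]⟩,
        ⟨[], .cross x y o, [x.flip]⟩, ⟨[y], .cap x, []⟩] :=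
      .replace 1 [] [x.flip] (equivalent_exchange (.cap x) (.cross x y o) []).symm
    Equivalent S [x, y, x.flip] [y] _
        [⟨[], .cross x y o, [x.flip]⟩, ⟨[y], .cap x, []⟩] :=
      .replace 0 [] [y, x.flip] (equivalent_zigzagLeft x)

/-- Half a turn of a crossing below which there are two nested minima. -/
theorem equivalent_cups_cross (a d : Dir) (o : Bool) :
    Equivalent S [] [d.flip, a.flip, d, a]
      [⟨[], .cup a.flip, []⟩, ⟨[a.flip], .cup d.flip, [a]⟩,
      ⟨[], .cross a.flip d.flip o, [d, a]⟩]
      [⟨[], .cup d.flip, []⟩, ⟨[d.flip], .cup a.flip, [d]⟩,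
      ⟨[d.flip, a.flip], .cross a d o, []⟩] := by
  calc
    Equivalent S [] [d.flip, a.flip, d, a]
        [⟨[], .cup a.flip, []⟩, ⟨[a.flip], .cup d.flip, [a]⟩,
        ⟨[], .cross a.flip d.flip o, [d, a]⟩]
        [⟨[], .cup a.flip, []⟩, ⟨[], .cup d.flip, [a.flip, a]⟩,
        ⟨[d.flip], .cross d a.flip (!o), [a]⟩] :=
      .replace 1 [] [a] (equivalent_cup_cross a.flip d.flip o)
    Equivalent S [] [d.flip, a.flip, d, a] _
        [⟨[], .cup d.flip, []⟩, ⟨[d.flip, d], .cup a.flip, []⟩,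
        ⟨[d.flip], .cross d a.flip (!o), [a]⟩] :=
      .replace 0 [] [] (equivalent_exchange (.cup d.flip) (.cup a.flip) []).symm
    Equivalent S [] [d.flip, a.flip, d, a] _
        [⟨[], .cup d.flip, []⟩, ⟨[d.flip], .cup a.flip, [d]⟩,
        ⟨[d.flip, a.flip], .cross a d o, []⟩] :=
      .replace 1 [d.flip] [] (equivalent_cup_cross d a.flip (!o))

/-- Half a turn of a crossing above which there are two nested maxima. -/
theorem equivalent_cross_caps (a b : Dir) (o : Bool) :
    Equivalent S [a, b, a.flip, b.flip] []
      [⟨[], .cross a b o, [a.flip, b.flip]⟩, ⟨[b], .cap a, [b.flip]⟩, ⟨[], .cap b, []⟩]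
      [⟨[a, b], .cross a.flip b.flip o, []⟩, ⟨[a], .cap b, [a.flip]⟩, ⟨[], .cap a, []⟩] := by
  calc
    Equivalent S [a, b, a.flip, b.flip] []
        [⟨[], .cross a b o, [a.flip, b.flip]⟩, ⟨[b], .cap a, [b.flip]⟩, ⟨[], .cap b, []⟩]
        [⟨[a], .cross b a.flip (!o), [b.flip]⟩, ⟨[], .cap a, [b, b.flip]⟩, ⟨[], .cap b, []⟩] :=
      .replace 0 [] [b.flip] (equivalent_cross_cap a b o).symm
    Equivalent S [a, b, a.flip, b.flip] [] _
        [⟨[a], .cross b a.flip (!o), [b.flip]⟩, ⟨[a, a.flip], .cap b, []⟩, ⟨[], .cap a, []⟩] :=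
      .replace 1 [] [] (equivalent_exchange (.cap a) (.cap b) [])
    Equivalent S [a, b, a.flip, b.flip] [] _
        [⟨[a, b], .cross a.flip b.flip o, []⟩, ⟨[a], .cap b, [a.flip]⟩, ⟨[], .cap a, []⟩] :=
      .replace 0 [a] [] (equivalent_cross_cap b a.flip (!o)).symm

/-- Half a turn of a bigon. -/
theorem Equivalent.bigon_halfTurn {a b : Dir} {o : Bool}
    (h : Equivalent S [a, b] [a, b] [⟨[], .cross a b o, []⟩, ⟨[], .cross b a (!o), []⟩] []) :
    Equivalent S [b.flip, a.flip] [b.flip, a.flip]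
      [⟨[], .cross b.flip a.flip (!o), []⟩, ⟨[], .cross a.flip b.flip o, []⟩]
      [] := by
  -- Zigzags are inserted in both strands between the crossings. The upper crossing is pulled down
  -- to the nested minima and turned there, the lower one is pushed up to the nested maxima and
  -- turned there; they meet in reversed order and form the bigon of `h`.
  calc
    Equivalent S [b.flip, a.flip] [b.flip, a.flip]
        [⟨[], .cross b.flip a.flip (!o), []⟩, ⟨[], .cross a.flip b.flip o, []⟩]
        [⟨[], .cross b.flip a.flip (!o), []⟩, ⟨[], .cup a.flip, [a.flip, b.flip]⟩,
        ⟨[a.flip], .cap a, [b.flip]⟩, ⟨[], .cross a.flip b.flip o, []⟩] :=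
      .replace 1 [] [b.flip] (equivalent_zigzagRight a.flip).symm
    Equivalent S [b.flip, a.flip] [b.flip, a.flip] _
        [⟨[], .cross b.flip a.flip (!o), []⟩, ⟨[], .cup a.flip, [a.flip, b.flip]⟩,
        ⟨[a.flip], .cap a, [b.flip]⟩, ⟨[a.flip], .cup b.flip, [b.flip]⟩,
        ⟨[a.flip, b.flip], .cap b, []⟩, ⟨[], .cross a.flip b.flip o, []⟩] :=
      .replace 3 [a.flip] [] (equivalent_zigzagRight b.flip).symm
    Equivalent S [b.flip, a.flip] [b.flip, a.flip] _
        [⟨[], .cross b.flip a.flip (!o), []⟩, ⟨[], .cup a.flip, [a.flip, b.flip]⟩,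
        ⟨[a.flip], .cup b.flip, [a, a.flip, b.flip]⟩, ⟨[a.flip, b.flip, b], .cap a, [b.flip]⟩,
        ⟨[a.flip, b.flip], .cap b, []⟩, ⟨[], .cross a.flip b.flip o, []⟩] :=
      .replace 2 [a.flip] [b.flip] (equivalent_exchange (.cup b.flip) (.cap a) []).symm
    Equivalent S [b.flip, a.flip] [b.flip, a.flip] _
        [⟨[], .cross b.flip a.flip (!o), []⟩, ⟨[], .cup a.flip, [a.flip, b.flip]⟩,
        ⟨[a.flip], .cup b.flip, [a, a.flip, b.flip]⟩, ⟨[a.flip, b.flip, b], .cap a, [b.flip]⟩,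
        ⟨[], .cross a.flip b.flip o, [b, b.flip]⟩, ⟨[b.flip, a.flip], .cap b, []⟩] :=
      .replace 4 [] [] (equivalent_exchange (.cross a.flip b.flip o) (.cap b) []).symm
    Equivalent S [b.flip, a.flip] [b.flip, a.flip] _
        [⟨[], .cross b.flip a.flip (!o), []⟩, ⟨[], .cup a.flip, [a.flip, b.flip]⟩,
        ⟨[a.flip], .cup b.flip, [a, a.flip, b.flip]⟩,
        ⟨[], .cross a.flip b.flip o, [b, a, a.flip, b.flip]⟩,
        ⟨[b.flip, a.flip, b], .cap a, [b.flip]⟩, ⟨[b.flip, a.flip], .cap b, []⟩] :=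
      .replace 3 [] [b.flip] (equivalent_exchange (.cross a.flip b.flip o) (.cap a) [b]).symm
    Equivalent S [b.flip, a.flip] [b.flip, a.flip] _
        [⟨[], .cross b.flip a.flip (!o), []⟩, ⟨[], .cup b.flip, [a.flip, b.flip]⟩,
        ⟨[b.flip], .cup a.flip, [b, a.flip, b.flip]⟩,
        ⟨[b.flip, a.flip], .cross a b o, [a.flip, b.flip]⟩,
        ⟨[b.flip, a.flip, b], .cap a, [b.flip]⟩, ⟨[b.flip, a.flip], .cap b, []⟩] :=
      .replace 1 [] [a.flip, b.flip] (equivalent_cups_cross a b o)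
    Equivalent S [b.flip, a.flip] [b.flip, a.flip] _
        [⟨[], .cup b.flip, [b.flip, a.flip]⟩, ⟨[b.flip, b], .cross b.flip a.flip (!o), []⟩,
        ⟨[b.flip], .cup a.flip, [b, a.flip, b.flip]⟩,
        ⟨[b.flip, a.flip], .cross a b o, [a.flip, b.flip]⟩,
        ⟨[b.flip, a.flip, b], .cap a, [b.flip]⟩, ⟨[b.flip, a.flip], .cap b, []⟩] :=
      .replace 0 [] [] (equivalent_exchange (.cup b.flip) (.cross b.flip a.flip (!o)) []).symm
    Equivalent S [b.flip, a.flip] [b.flip, a.flip] _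
        [⟨[], .cup b.flip, [b.flip, a.flip]⟩, ⟨[b.flip], .cup a.flip, [b, b.flip, a.flip]⟩,
        ⟨[b.flip, a.flip, a, b], .cross b.flip a.flip (!o), []⟩,
        ⟨[b.flip, a.flip], .cross a b o, [a.flip, b.flip]⟩,
        ⟨[b.flip, a.flip, b], .cap a, [b.flip]⟩, ⟨[b.flip, a.flip], .cap b, []⟩] :=
      .replace 1 [b.flip] []
        (equivalent_exchange (.cup a.flip) (.cross b.flip a.flip (!o)) [b]).symm
    Equivalent S [b.flip, a.flip] [b.flip, a.flip] _
        [⟨[], .cup b.flip, [b.flip, a.flip]⟩, ⟨[b.flip], .cup a.flip, [b, b.flip, a.flip]⟩,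
        ⟨[b.flip, a.flip], .cross a b o, [b.flip, a.flip]⟩,
        ⟨[b.flip, a.flip, b, a], .cross b.flip a.flip (!o), []⟩,
        ⟨[b.flip, a.flip, b], .cap a, [b.flip]⟩, ⟨[b.flip, a.flip], .cap b, []⟩] :=
      .replace 2 [b.flip, a.flip] []
        (equivalent_exchange (.cross a b o) (.cross b.flip a.flip (!o)) []).symm
    Equivalent S [b.flip, a.flip] [b.flip, a.flip] _
        [⟨[], .cup b.flip, [b.flip, a.flip]⟩, ⟨[b.flip], .cup a.flip, [b, b.flip, a.flip]⟩,
        ⟨[b.flip, a.flip], .cross a b o, [b.flip, a.flip]⟩,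
        ⟨[b.flip, a.flip], .cross b a (!o), [b.flip, a.flip]⟩,
        ⟨[b.flip, a.flip, a], .cap b, [a.flip]⟩, ⟨[b.flip, a.flip], .cap a, []⟩] :=
      .replace 3 [b.flip, a.flip] [] (equivalent_cross_caps b a (!o)).symm
    Equivalent S [b.flip, a.flip] [b.flip, a.flip] _
        [⟨[], .cup b.flip, [b.flip, a.flip]⟩, ⟨[b.flip], .cup a.flip, [b, b.flip, a.flip]⟩,
        ⟨[b.flip, a.flip, a], .cap b, [a.flip]⟩, ⟨[b.flip, a.flip], .cap a, []⟩] :=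
      .replace 2 [b.flip, a.flip] [b.flip, a.flip] h
    Equivalent S [b.flip, a.flip] [b.flip, a.flip] _
        [⟨[], .cup b.flip, [b.flip, a.flip]⟩, ⟨[b.flip], .cap b, [a.flip]⟩,
        ⟨[b.flip], .cup a.flip, [a.flip]⟩, ⟨[b.flip, a.flip], .cap a, []⟩] :=
      .replace 1 [b.flip] [a.flip] (equivalent_exchange (.cup a.flip) (.cap b) [])
    Equivalent S [b.flip, a.flip] [b.flip, a.flip] _
        [⟨[b.flip], .cup a.flip, [a.flip]⟩, ⟨[b.flip, a.flip], .cap a, []⟩] :=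
      .replace 0 [] [a.flip] (equivalent_zigzagRight b.flip)
    Equivalent S [b.flip, a.flip] [b.flip, a.flip] _
        [] :=
      .replace 0 [b.flip] [] (equivalent_zigzagRight a.flip)

/-- A slide of a strand across a vertex, after half a turn: the strand crosses one upper leg on one
side of the move, and the other two legs on the other side. -/
theorem Equivalent.slide_halfTurn {d a : Dir} {o : Bool}
    (h : Equivalent S [a, d] [d.flip, d.flip, a] [⟨[], .cross a d o, []⟩, ⟨[], .vertex d, [a]⟩]
      [⟨[a], .vertex d, []⟩, ⟨[], .cross a d.flip o, [d.flip]⟩, ⟨[d.flip], .cross a d.flip o, []⟩]) :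
    Equivalent S [a.flip, d] [d.flip, a.flip, d.flip]
      [⟨[a.flip], .vertex d, []⟩, ⟨[], .cross a.flip d.flip o, [d.flip]⟩]
      [⟨[], .cross a.flip d o, []⟩, ⟨[], .vertex d, [a.flip]⟩,
      ⟨[d.flip], .cross d.flip a.flip (!o), []⟩] := by
  -- A third of a turn makes the left upper leg the lower leg of the turned vertex, and a zigzag
  -- reverses the strand locally. The crossing, moved below the vertex and turned by a half, is the
  -- one in `h`. After `h`, the crossing with the right leg is turned back and becomes the one with
  -- the original lower leg; turning the vertex and the last crossing back ends the proof.
  calc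
    Equivalent S [a.flip, d] [d.flip, a.flip, d.flip]
        [⟨[a.flip], .vertex d, []⟩, ⟨[], .cross a.flip d.flip o, [d.flip]⟩]
        [⟨[a.flip], .cup d.flip, [d]⟩, ⟨[a.flip, d.flip], .vertex d, [d]⟩,
        ⟨[a.flip, d.flip, d.flip], .cap d.flip, []⟩, ⟨[], .cross a.flip d.flip o, [d.flip]⟩] :=
      .replace 0 [a.flip] [] (equivalent_turnVertex d)
    Equivalent S [a.flip, d] [d.flip, a.flip, d.flip] _
        [⟨[a.flip], .cup d.flip, [d]⟩, ⟨[a.flip, d.flip], .vertex d, [d]⟩,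
        ⟨[], .cross a.flip d.flip o, [d.flip, d.flip, d]⟩,
        ⟨[d.flip, a.flip, d.flip], .cap d.flip, []⟩] :=
      .replace 2 [] [] (equivalent_exchange (.cross a.flip d.flip o) (.cap d.flip) [d.flip]).symm
    Equivalent S [a.flip, d] [d.flip, a.flip, d.flip] _
        [⟨[a.flip], .cup d.flip, [d]⟩, ⟨[], .cross a.flip d.flip o, [d, d]⟩,
        ⟨[d.flip, a.flip], .vertex d, [d]⟩, ⟨[d.flip, a.flip, d.flip], .cap d.flip, []⟩] :=
      .replace 1 [] [d] (equivalent_exchange (.cross a.flip d.flip o) (.vertex d) []).symm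
    Equivalent S [a.flip, d] [d.flip, a.flip, d.flip] _
        [⟨[], .cup a.flip, [a.flip, d]⟩, ⟨[a.flip], .cap a, [d]⟩, ⟨[a.flip], .cup d.flip, [d]⟩,
        ⟨[], .cross a.flip d.flip o, [d, d]⟩, ⟨[d.flip, a.flip], .vertex d, [d]⟩,
        ⟨[d.flip, a.flip, d.flip], .cap d.flip, []⟩] :=
      .replace 0 [] [d] (equivalent_zigzagRight a.flip).symm
    Equivalent S [a.flip, d] [d.flip, a.flip, d.flip] _
        [⟨[], .cup a.flip, [a.flip, d]⟩, ⟨[a.flip], .cup d.flip, [a, a.flip, d]⟩,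
        ⟨[a.flip, d.flip, d], .cap a, [d]⟩, ⟨[], .cross a.flip d.flip o, [d, d]⟩,
        ⟨[d.flip, a.flip], .vertex d, [d]⟩, ⟨[d.flip, a.flip, d.flip], .cap d.flip, []⟩] :=
      .replace 1 [a.flip] [d] (equivalent_exchange (.cup d.flip) (.cap a) []).symm
    Equivalent S [a.flip, d] [d.flip, a.flip, d.flip] _
        [⟨[], .cup a.flip, [a.flip, d]⟩, ⟨[a.flip], .cup d.flip, [a, a.flip, d]⟩,
        ⟨[], .cross a.flip d.flip o, [d, a, a.flip, d]⟩, ⟨[d.flip, a.flip, d], .cap a, [d]⟩,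
        ⟨[d.flip, a.flip], .vertex d, [d]⟩, ⟨[d.flip, a.flip, d.flip], .cap d.flip, []⟩] :=
      .replace 2 [] [d] (equivalent_exchange (.cross a.flip d.flip o) (.cap a) [d]).symm
    Equivalent S [a.flip, d] [d.flip, a.flip, d.flip] _
        [⟨[], .cup a.flip, [a.flip, d]⟩, ⟨[a.flip], .cup d.flip, [a, a.flip, d]⟩,
        ⟨[], .cross a.flip d.flip o, [d, a, a.flip, d]⟩,
        ⟨[d.flip, a.flip], .vertex d, [a, a.flip, d]⟩,
        ⟨[d.flip, a.flip, d.flip, d.flip], .cap a, [d]⟩,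
        ⟨[d.flip, a.flip, d.flip], .cap d.flip, []⟩] :=
      .replace 3 [d.flip, a.flip] [d] (equivalent_exchange (.vertex d) (.cap a) []).symm
    Equivalent S [a.flip, d] [d.flip, a.flip, d.flip] _
        [⟨[], .cup d.flip, [a.flip, d]⟩, ⟨[d.flip], .cup a.flip, [d, a.flip, d]⟩,
        ⟨[d.flip, a.flip], .cross a d o, [a.flip, d]⟩,
        ⟨[d.flip, a.flip], .vertex d, [a, a.flip, d]⟩,
        ⟨[d.flip, a.flip, d.flip, d.flip], .cap a, [d]⟩,
        ⟨[d.flip, a.flip, d.flip], .cap d.flip, []⟩] :=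
      .replace 0 [] [a.flip, d] (equivalent_cups_cross a d o)
    Equivalent S [a.flip, d] [d.flip, a.flip, d.flip] _
        [⟨[], .cup d.flip, [a.flip, d]⟩, ⟨[d.flip], .cup a.flip, [d, a.flip, d]⟩,
        ⟨[d.flip, a.flip, a], .vertex d, [a.flip, d]⟩,
        ⟨[d.flip, a.flip], .cross a d.flip o, [d.flip, a.flip, d]⟩,
        ⟨[d.flip, a.flip, d.flip], .cross a d.flip o, [a.flip, d]⟩,
        ⟨[d.flip, a.flip, d.flip, d.flip], .cap a, [d]⟩,
        ⟨[d.flip, a.flip, d.flip], .cap d.flip, []⟩] :=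
      .replace 2 [d.flip, a.flip] [a.flip, d] h
    Equivalent S [a.flip, d] [d.flip, a.flip, d.flip] _
        [⟨[], .cup d.flip, [a.flip, d]⟩, ⟨[d.flip], .cup a.flip, [d, a.flip, d]⟩,
        ⟨[d.flip, a.flip, a], .vertex d, [a.flip, d]⟩,
        ⟨[d.flip, a.flip], .cross a d.flip o, [d.flip, a.flip, d]⟩,
        ⟨[d.flip, a.flip, d.flip, a, d.flip], .cross a.flip d o, []⟩,
        ⟨[d.flip, a.flip, d.flip, a], .cap d.flip, [a.flip]⟩,
        ⟨[d.flip, a.flip, d.flip], .cap a, []⟩] :=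
      .replace 4 [d.flip, a.flip, d.flip] [] (equivalent_cross_caps a d.flip o)
    Equivalent S [a.flip, d] [d.flip, a.flip, d.flip] _
        [⟨[], .cup d.flip, [a.flip, d]⟩, ⟨[d.flip], .cup a.flip, [d, a.flip, d]⟩,
        ⟨[d.flip, a.flip, a], .vertex d, [a.flip, d]⟩,
        ⟨[d.flip, a.flip, a, d.flip, d.flip], .cross a.flip d o, []⟩,
        ⟨[d.flip, a.flip], .cross a d.flip o, [d.flip, d, a.flip]⟩,
        ⟨[d.flip, a.flip, d.flip, a], .cap d.flip, [a.flip]⟩,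
        ⟨[d.flip, a.flip, d.flip], .cap a, []⟩] :=
      .replace 3 [d.flip, a.flip] []
        (equivalent_exchange (.cross a d.flip o) (.cross a.flip d o) [d.flip])
    Equivalent S [a.flip, d] [d.flip, a.flip, d.flip] _
        [⟨[], .cup d.flip, [a.flip, d]⟩, ⟨[d.flip], .cup a.flip, [d, a.flip, d]⟩,
        ⟨[d.flip, a.flip, a, d], .cross a.flip d o, []⟩,
        ⟨[d.flip, a.flip, a], .vertex d, [d, a.flip]⟩,
        ⟨[d.flip, a.flip], .cross a d.flip o, [d.flip, d, a.flip]⟩,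
        ⟨[d.flip, a.flip, d.flip, a], .cap d.flip, [a.flip]⟩,
        ⟨[d.flip, a.flip, d.flip], .cap a, []⟩] :=
      .replace 2 [d.flip, a.flip, a] [] (equivalent_exchange (.vertex d) (.cross a.flip d o) [])
    Equivalent S [a.flip, d] [d.flip, a.flip, d.flip] _
        [⟨[], .cup d.flip, [a.flip, d]⟩, ⟨[d.flip, d], .cross a.flip d o, []⟩,
        ⟨[d.flip], .cup a.flip, [d, d, a.flip]⟩, ⟨[d.flip, a.flip, a], .vertex d, [d, a.flip]⟩,
        ⟨[d.flip, a.flip], .cross a d.flip o, [d.flip, d, a.flip]⟩,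
        ⟨[d.flip, a.flip, d.flip, a], .cap d.flip, [a.flip]⟩,
        ⟨[d.flip, a.flip, d.flip], .cap a, []⟩] :=
      .replace 1 [d.flip] [] (equivalent_exchange (.cup a.flip) (.cross a.flip d o) [d])
    Equivalent S [a.flip, d] [d.flip, a.flip, d.flip] _
        [⟨[], .cross a.flip d o, []⟩, ⟨[], .cup d.flip, [d, a.flip]⟩,
        ⟨[d.flip], .cup a.flip, [d, d, a.flip]⟩, ⟨[d.flip, a.flip, a], .vertex d, [d, a.flip]⟩,
        ⟨[d.flip, a.flip], .cross a d.flip o, [d.flip, d, a.flip]⟩,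
        ⟨[d.flip, a.flip, d.flip, a], .cap d.flip, [a.flip]⟩,
        ⟨[d.flip, a.flip, d.flip], .cap a, []⟩] :=
      .replace 0 [] [] (equivalent_exchange (.cup d.flip) (.cross a.flip d o) [])
    Equivalent S [a.flip, d] [d.flip, a.flip, d.flip] _
        [⟨[], .cross a.flip d o, []⟩, ⟨[], .cup d.flip, [d, a.flip]⟩,
        ⟨[d.flip], .cup a.flip, [d, d, a.flip]⟩, ⟨[d.flip, a.flip, a], .vertex d, [d, a.flip]⟩,
        ⟨[d.flip, a.flip, a, d.flip], .cap d.flip, [a.flip]⟩,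
        ⟨[d.flip, a.flip], .cross a d.flip o, [a.flip]⟩,
        ⟨[d.flip, a.flip, d.flip], .cap a, []⟩] :=
      .replace 4 [d.flip, a.flip] [a.flip]
        (equivalent_exchange (.cross a d.flip o) (.cap d.flip) [])
    Equivalent S [a.flip, d] [d.flip, a.flip, d.flip] _
        [⟨[], .cross a.flip d o, []⟩, ⟨[], .cup d.flip, [d, a.flip]⟩,
        ⟨[d.flip], .vertex d, [d, a.flip]⟩,
        ⟨[d.flip], .cup a.flip, [d.flip, d.flip, d, a.flip]⟩,
        ⟨[d.flip, a.flip, a, d.flip], .cap d.flip, [a.flip]⟩,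
        ⟨[d.flip, a.flip], .cross a d.flip o, [a.flip]⟩,
        ⟨[d.flip, a.flip, d.flip], .cap a, []⟩] :=
      .replace 2 [d.flip] [d, a.flip] (equivalent_exchange (.cup a.flip) (.vertex d) [])
    Equivalent S [a.flip, d] [d.flip, a.flip, d.flip] _
        [⟨[], .cross a.flip d o, []⟩, ⟨[], .cup d.flip, [d, a.flip]⟩,
        ⟨[d.flip], .vertex d, [d, a.flip]⟩, ⟨[d.flip, d.flip], .cap d.flip, [a.flip]⟩,
        ⟨[d.flip], .cup a.flip, [d.flip, a.flip]⟩,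
        ⟨[d.flip, a.flip], .cross a d.flip o, [a.flip]⟩,
        ⟨[d.flip, a.flip, d.flip], .cap a, []⟩] :=
      .replace 3 [d.flip] [a.flip] (equivalent_exchange (.cup a.flip) (.cap d.flip) [d.flip])
    Equivalent S [a.flip, d] [d.flip, a.flip, d.flip] _
        [⟨[], .cross a.flip d o, []⟩, ⟨[], .vertex d, [a.flip]⟩,
        ⟨[d.flip], .cup a.flip, [d.flip, a.flip]⟩,
        ⟨[d.flip, a.flip], .cross a d.flip o, [a.flip]⟩,
        ⟨[d.flip, a.flip, d.flip], .cap a, []⟩] :=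
      .replace 1 [] [a.flip] (equivalent_turnVertex d).symm
    Equivalent S [a.flip, d] [d.flip, a.flip, d.flip] _
        [⟨[], .cross a.flip d o, []⟩, ⟨[], .vertex d, [a.flip]⟩,
        ⟨[d.flip], .cross d.flip a.flip (!o), []⟩] :=
      .replace 2 [d.flip] [] (equivalent_turnCross d.flip a.flip (!o)).symm

/-- A slide of a strand across a vertex, with the direction of the strand reversed. -/
theorem Equivalent.slide_flip {d a : Dir} {o : Bool}
    (h : Equivalent S [a, d] [d.flip, d.flip, a] [⟨[], .cross a d o, []⟩, ⟨[], .vertex d, [a]⟩]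
      [⟨[a], .vertex d, []⟩, ⟨[], .cross a d.flip o, [d.flip]⟩, ⟨[d.flip], .cross a d.flip o, []⟩])
    (h₂ : Equivalent S [d.flip, a.flip] [d.flip, a.flip]
      [⟨[], .cross d.flip a.flip (!o), []⟩, ⟨[], .cross a.flip d.flip o, []⟩] []) :
    Equivalent S [a.flip, d] [d.flip, d.flip, a.flip]
      [⟨[], .cross a.flip d o, []⟩, ⟨[], .vertex d, [a.flip]⟩]
      [⟨[a.flip], .vertex d, []⟩, ⟨[], .cross a.flip d.flip o, [d.flip]⟩,
      ⟨[d.flip], .cross a.flip d.flip o, []⟩] := by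
  calc
    Equivalent S [a.flip, d] [d.flip, d.flip, a.flip]
        [⟨[], .cross a.flip d o, []⟩, ⟨[], .vertex d, [a.flip]⟩]
        [⟨[], .cross a.flip d o, []⟩, ⟨[], .vertex d, [a.flip]⟩,
        ⟨[d.flip], .cross d.flip a.flip (!o), []⟩, ⟨[d.flip], .cross a.flip d.flip o, []⟩] :=
      .replace 2 [d.flip] [] h₂.symm
    -- The crossings with the lower leg and, from the new bigon, with the right upper leg are traded
    -- for one with the left upper leg; the other crossing of the bigon remains.
    Equivalent S [a.flip, d] [d.flip, d.flip, a.flip] _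
        [⟨[a.flip], .vertex d, []⟩, ⟨[], .cross a.flip d.flip o, [d.flip]⟩,
        ⟨[d.flip], .cross a.flip d.flip o, []⟩] :=
      .replace 0 [] [] h.slide_halfTurn.symm

/-- The moves of type 2 realize all oriented versions of the bigon. -/
theorem equivalent_bigon (hS : omega2 ⊆ S) (a b : Dir) (o : Bool) :
    Equivalent S [a, b] [a, b] [⟨[], .cross a b o, []⟩, ⟨[], .cross b a (!o), []⟩] [] := by
  have key : ∀ m ∈ omega2, Equivalent S m.pair.bottom m.pair.top m.pair.rhs.slices
      m.pair.lhs.slices := fun m hm => (equivalent_of_eqvGen (realizes_of_mem (hS hm))).symm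
  have hA := key .om2a (by decide)
  have hB := key .om2b (by decide)
  have hC := key .om2c (by decide)
  have hD := key .om2d (by decide)
  -- A half turn exchanges upward and downward parallel strands, and for antiparallel strands it
  -- exchanges the upper strand with the lower one.
  cases a <;> cases b <;> cases o
  · exact hB
  · exact hA
  · exact Equivalent.bigon_halfTurn hC
  · exact hC
  · exact Equivalent.bigon_halfTurn hD
  · exact hD
  · exact Equivalent.bigon_halfTurn hA
  · exact Equivalent.bigon_halfTurn hB

theorem realizes_vertexSlide_flip {x y : Move} {d a : Dir} {o : Bool} (hS : omega2 ⊆ S)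
    (hy : Realizes S y) (hyp : y.pair = vertexSlide d a o)
    (hxp : x.pair = vertexSlide d a.flip o) : Realizes S x := by
  have h := equivalent_of_eqvGen hy
  rw [hyp] at h
  refine eqvGen_of_equivalent ?_
  rw [hxp]
  refine Equivalent.slide_flip h ?_
  simpa using equivalent_bigon hS d.flip a.flip (!o)

end TrivalentDiagram

namespace TrivalentDiagram

/-! ### Diagrams without vertices -/

/-- Whether a stack contains no trivalent vertex. -/
def vertexFree (w : List Slice) : Bool :=
  w.all fun s => match s.piece with
    | .vertex _ => false
    | _ => true

theorem vertexFree_append (u v : List Slice) :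
    vertexFree (u ++ v) = (vertexFree u && vertexFree v) :=
  List.all_append

theorem vertexFree_pad (l r : List Dir) (w : List Slice) :
    vertexFree (pad l r w) = vertexFree w := by
  simp only [vertexFree, pad, List.all_map]
  rfl

variable {S : Finset Move} {p q : List Dir}

theorem Isotopy.vertexFree_eq {u v : List Slice} (h : Isotopy u v) :
    vertexFree u = vertexFree v := by
  cases h with
  | exchange g h m => simp [vertexFree, Bool.and_comm]
  | _ => rfl

theorem LocalChange.vertexFree_eq {u v : List Slice} (h : LocalChange S u v) :
    vertexFree u = vertexFree v := by
  cases h with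
  | isotopy h => exact h.vertexFree_eq
  | move m _ => cases m <;> rfl

/-- Both sides of an Ω4 move contain a vertex, so no such move applies to a stack without vertices.
-/
theorem LocalChange.sdiff_omega4 {u v : List Slice} (h : LocalChange S u v)
    (hu : vertexFree u = true) : LocalChange (S \ omega4) u v := by
  cases h with
  | isotopy h => exact .isotopy h
  | move m hm =>
    refine .move m (Finset.mem_sdiff.2 ⟨hm, ?_⟩)
    cases m <;> first | decide | exact absurd hu (by decide)

/-- The slides across vertices are of no use for a move between diagrams without vertices. -/
theorem Realizes.sdiff_omega4 {m : Move} (h : Realizes S m)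
    (hm : vertexFree m.pair.lhs.slices = true) : Realizes (S \ omega4) m := by
  -- The equality is carried along because symmetry and transitivity need vertex-freeness of the
  -- other diagrams of the sequence.
  have key : ∀ D D' : Diagram m.pair.bottom m.pair.top, Relation.EqvGen (Step S) D D' →
      vertexFree D.slices = vertexFree D'.slices ∧
        (vertexFree D.slices = true → Relation.EqvGen (Step (S \ omega4)) D D') := by
    intro D D' e
    induction e with
    | rel D D' h =>
      obtain ⟨u, v, below, above, l, r, h, hD, hD'⟩ := h
      refine ⟨by simp only [hD, hD', vertexFree_append, vertexFree_pad, h.vertexFree_eq],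
        fun hf => .rel _ _ ⟨u, v, below, above, l, r, h.sdiff_omega4 ?_, hD, hD'⟩⟩
      simp only [hD, vertexFree_append, vertexFree_pad, Bool.and_eq_true] at hf
      exact hf.1.2
    | refl D => exact ⟨rfl, fun _ => .refl _⟩
    | symm _ _ _ ih => exact ⟨ih.1.symm, fun hf => (ih.2 (ih.1.trans hf)).symm⟩
    | trans _ _ _ _ _ ih ih' =>
      exact ⟨ih.1.trans ih'.1, fun hf => .trans _ _ _ (ih.2 hf) (ih'.2 (ih.1.symm.trans hf))⟩
  exact (key _ _ h).2 hm

/-! ### Generating sets -/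

theorem IsGenerating.sdiff_omega4_realizes (hS : IsGenerating S) {m : Move} (hm : m ∈ omega2) :
    Realizes (S \ omega4) m :=
  (hS m).sdiff_omega4 (by cases m <;> first | rfl | exact absurd hm (by decide))

/-- Each move of a pair is realized by the other one together with the moves of type 2. -/
theorem realizes_of_mem_pair {P : Finset Move} (hP : P ∈ omega4Pairs) {x y : Move} (hx : x ∈ P)
    (hy : y ∈ P) : Realizes (insert y omega2) x := by
  by_cases hxy : x = y
  · exact realizes_of_mem (hxy ▸ Finset.mem_insert_self _ _)
  have h := realizes_of_mem (Finset.mem_insert_self y omega2)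
  have hS := Finset.subset_insert y omega2
  simp only [omega4Pairs, List.mem_cons, List.not_mem_nil, or_false] at hP
  rcases hP with rfl | rfl | rfl | rfl <;>
    simp only [Finset.mem_insert, Finset.mem_singleton] at hx hy <;>
    rcases hx with rfl | rfl <;> rcases hy with rfl | rfl <;>
    first
    | exact absurd rfl hxy
    | exact realizes_vertexSlide_flip hS h rfl rfl

/-- The Ω2 moves need only be realized by `S`, not belong to it: a minimal generating set need not
contain all four. -/
theorem realizes_of_pair {P : Finset Move} (hP : P ∈ omega4Pairs) {x y : Move} (hx : x ∈ P)
    (hy : y ∈ P) (hyS : y ∈ S) (hS : ∀ m ∈ omega2, Realizes S m) : Realizes S x :=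
  (realizes_of_mem_pair hP hx hy).trans fun m hm => by
    rcases Finset.mem_insert.1 hm with rfl | hm
    · exact realizes_of_mem hyS
    · exact hS m hm

/-- Every generating set contains a move of each pair. -/
theorem IsGenerating.inter_pair_nonempty (hS : IsGenerating S) {P : Finset Move}
    (hP : P ∈ omega4Pairs) : (S ∩ P).Nonempty := by
  simp only [omega4Pairs, List.mem_cons, List.not_mem_nil, or_false] at hP
  rcases hP with rfl | rfl | rfl | rfl
  · exact Realizes.inter_slides_nonempty (hS .om4a) (d₀ := .up) (o₀ := false) (by decide)
  · exact Realizes.inter_slides_nonempty (hS .om4c) (d₀ := .up) (o₀ := true) (by decide)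
  · exact Realizes.inter_slides_nonempty (hS .om4e) (d₀ := .down) (o₀ := false) (by decide)
  · exact Realizes.inter_slides_nonempty (hS .om4g) (d₀ := .down) (o₀ := true) (by decide)

theorem mem_omega4_iff {m : Move} : m ∈ omega4 ↔ ∃ P ∈ omega4Pairs, m ∈ P := by
  simp [omega4, omega4Pairs, or_assoc]

/-- A minimal generating set contains exactly one move of each pair. -/
theorem IsMinimalGenerating.card_inter_pair (hS : IsMinimalGenerating S) {P : Finset Move}
    (hP : P ∈ omega4Pairs) : (S ∩ P).card = 1 := by
  refine le_antisymm (Finset.card_le_one.2 fun x hx y hy => ?_)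
    (Finset.card_pos.2 (hS.1.inter_pair_nonempty hP))
  by_contra hxy
  obtain ⟨hxS, hxP⟩ := Finset.mem_inter.1 hx
  obtain ⟨hyS, hyP⟩ := Finset.mem_inter.1 hy
  -- This avoids circularity: Ω2 is realized without any Ω4 move, so it is still available after `x`
  -- is removed and can be used to recover `x` from `y`.
  have hsub : S \ omega4 ⊆ S.erase x := fun m hm => by
    obtain ⟨hmS, hm4⟩ := Finset.mem_sdiff.1 hm
    exact Finset.mem_erase.2 ⟨fun h => hm4 (mem_omega4_iff.2 ⟨P, hP, h ▸ hxP⟩), hmS⟩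
  have hgen : IsGenerating (S.erase x) := fun m => (hS.1 m).trans fun z hz => by
    by_cases hzx : z = x
    · subst hzx
      exact realizes_of_pair hP hxP hyP (Finset.mem_erase.2 ⟨Ne.symm hxy, hyS⟩)
        fun m hm => (hS.1.sdiff_omega4_realizes hm).mono hsub
    · exact realizes_of_mem (Finset.mem_erase.2 ⟨hzx, hz⟩)
  exact absurd (hS.2 _ hgen) (not_le.2 (Finset.card_erase_lt_of_mem hxS))

theorem card_inter_omega4 {T : Finset Move} (hT : ∀ P ∈ omega4Pairs, (T ∩ P).card = 1) :
    (T ∩ omega4).card = 4 := by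
  have h : omega4 = ({.om4a, .om4b} ∪ {.om4c, .om4d}) ∪ ({.om4e, .om4f} ∪ {.om4g, .om4h}) := by
    decide
  simp only [omega4Pairs, List.forall_mem_cons] at hT
  obtain ⟨h1, h2, h3, h4, -⟩ := hT
  have disj : ∀ A B : Finset Move, Disjoint A B → Disjoint (T ∩ A) (T ∩ B) := fun A B hAB =>
    hAB.mono Finset.inter_subset_right Finset.inter_subset_right
  rw [h, Finset.inter_union_distrib_left, Finset.card_union_of_disjoint (disj _ _ (by decide)),
    Finset.inter_union_distrib_left, Finset.card_union_of_disjoint (disj _ _ (by decide)),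
    Finset.inter_union_distrib_left, Finset.card_union_of_disjoint (disj _ _ (by decide)),
    h1, h2, h3, h4]

/-- The set of all moves generates, so there is a least cardinality of a generating set. -/
theorem exists_isMinimalGenerating : ∃ S : Finset Move, IsMinimalGenerating S := by
  let A : Finset Move := {.om1a, .om1b, .om1c, .om1d, .om2a, .om2b, .om2c, .om2d, .om3a, .om3b,
    .om3c, .om3d, .om3e, .om3f, .om3g, .om3h, .om4a, .om4b, .om4c, .om4d, .om4e, .om4f, .om4g,
    .om4h, .om5a, .om5b, .om5c, .om5d}
  have hA : IsGenerating A := fun m => realizes_of_mem (by cases m <;> decide)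
  classical
  have h : ∃ n, ∃ S : Finset Move, IsGenerating S ∧ S.card = n := ⟨_, A, hA, rfl⟩
  obtain ⟨S, hS, hn⟩ := Nat.find_spec h
  exact ⟨S, hS, fun R hR => hn ▸ Nat.find_min' h ⟨R, hR, rfl⟩⟩

/-- Exchange argument: in any minimal generating set the four Ω4 moves are replaced by `T`. The rest
still realizes Ω2, which together with `T` recovers the Ω4 moves that were removed. -/
theorem exists_isMinimalGenerating_inter_eq {T : Finset Move} (hT : T ⊆ omega4)
    (hT1 : ∀ P ∈ omega4Pairs, (T ∩ P).card = 1) :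
    ∃ S : Finset Move, IsMinimalGenerating S ∧ S ∩ omega4 = T := by
  obtain ⟨S, hS⟩ := exists_isMinimalGenerating
  have hcard : (S \ omega4 ∪ T).card = S.card := by
    rw [Finset.card_union_of_disjoint (Finset.sdiff_disjoint.mono_right hT),
      ← Finset.card_sdiff_add_card_inter S omega4,
      card_inter_omega4 fun P hP => hS.card_inter_pair hP, ← card_inter_omega4 hT1,
      Finset.inter_eq_left.2 hT]
  have hgen : IsGenerating (S \ omega4 ∪ T) := fun m => (hS.1 m).trans fun x hx => by
    by_cases hx4 : x ∈ omega4
    · obtain ⟨P, hP, hxP⟩ := mem_omega4_iff.1 hx4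
      obtain ⟨y, hy⟩ := Finset.card_pos.1 (Nat.lt_of_lt_of_eq Nat.one_pos (hT1 P hP).symm)
      obtain ⟨hyT, hyP⟩ := Finset.mem_inter.1 hy
      exact realizes_of_pair hP hxP hyP (Finset.mem_union_right _ hyT) fun m hm =>
        (hS.1.sdiff_omega4_realizes hm).mono Finset.subset_union_left
    · exact realizes_of_mem (Finset.mem_union_left _ (Finset.mem_sdiff.2 ⟨hx, hx4⟩))
  refine ⟨S \ omega4 ∪ T, ⟨hgen, fun R hR => hcard.trans_le (hS.2 R hR)⟩, ?_⟩
  rw [Finset.union_inter_distrib_right, Finset.sdiff_inter_self, Finset.empty_union,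
    Finset.inter_eq_left.2 hT]

end TrivalentDiagram

theorem mainTheorem6 :
    (∀ S : Finset Move, IsMinimalGenerating S →
      (S ∩ omega4).card = 4 ∧ ∀ P ∈ omega4Pairs, (S ∩ P).card = 1) ∧
    (∀ S : Finset Move, IsGenerating S → ∀ P ∈ omega4Pairs, (S ∩ P).Nonempty) ∧
    (∀ P ∈ omega4Pairs, ∀ x ∈ P, ∀ y ∈ P, Realizes (insert y omega2) x) ∧
    (∀ T : Finset Move, T ⊆ omega4 → (∀ P ∈ omega4Pairs, (T ∩ P).card = 1) →
      ∃ S : Finset Move, IsMinimalGenerating S ∧ S ∩ omega4 = T) :=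
  ⟨fun _ hS => ⟨card_inter_omega4 fun _ hP => hS.card_inter_pair hP,
      fun _ hP => hS.card_inter_pair hP⟩,
    fun _ hS _ hP => hS.inter_pair_nonempty hP,
    fun _ hP _ hx _ hy => realizes_of_mem_pair hP hx hy,
    fun _ hT hT1 => exists_isMinimalGenerating_inter_eq hT hT1⟩
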